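/- **Uniqueness neglecting radiation.** Let $\Omega\subset\mathbb R^3$ be a bounded open set with piecewise smooth boundary $\partial\Omega=\overline\Omega\setminus\Omega$, let $\mathcal T>0$, and let $\partial\Omega$ be the disjoint union of $\Gamma^{\vartheta}$, $\Gamma^{q}$ and $\Gamma^{\mathrm N}$. Let the vasculature $\Sigma$ be a simple piecewise $C^1$ curve $\gamma:[0,L]\to\overline\Omega$, parametrized by arc-length $s$, running inside $\Omega$ from the inlet $\gamma(0)\in\partial\Omega$ to the outlet $\gamma(L)\in\partial\Omega$, with unit tangent $\widehat{\mathbf t}$. Let $\rho_s,c_s>0$ be bounded measurable functions on $\Omega$ (for instance constants), let the conductivity $\mathbf K(\mathbf x)$ be measurable and positive definite at every $\mathbf x\in\Omega$, and let $h_T\ge 0$, $\varepsilon\ge0$, $\sigma>0$, $\chi=\dot m\,c_f$ with $\dot m=\rho_fQ\ge 0$ and $c_f\ge 0$. For given data $\vartheta^{\mathrm p},q^{\mathrm p},\vartheta_{\mathrm{amb}},\vartheta_{\mathrm{inlet}},\vartheta_{\mathrm{initial}}$ consider the model $$\rho_sc_s\,\partial_t\vartheta+\mathrm{div}\,\mathbf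 q=0,\qquad \mathbf q=-\mathbf K\,\mathrm{grad}\,\vartheta\quad\text{in }\Omega,$$ $$\vartheta=\vartheta^{\mathrm p}\ \text{on }\Gamma^{\vartheta},\qquad \mathbf q\cdot\widehat{\mathbf n}=q^{\mathrm p}\ \text{on }\Gamma^{q},\qquad \mathbf q\cdot\widehat{\mathbf n}=h_T(\vartheta-\vartheta_{\mathrm{amb}})+\varepsilon\sigma(\vartheta^4-\vartheta_{\mathrm{amb}}^4)\ \text{on }\Gamma^{\mathrm N},$$ $$[\![\vartheta]\!]=0,\qquad [\![\mathbf q]\!]=\chi\,\mathrm{grad}\,\vartheta\cdot\widehat{\mathbf t}=\chi\,\frac{\partial\vartheta}{\partial s}\ \text{on }\Sigma,$$ $$\vartheta(\cdot,0)=\vartheta_{\mathrm{initial}}\ \text{in }\Omega,\qquad \vartheta(\gamma(0),t)=\vartheta_{\mathrm{inlet}}.$$ Solutions are understood as follows. The map $t\mapsto\vartheta(\cdot,t)$ is continuous from $[0,\mathcal T]$ to $L^2(\Omega)$ and differentiable on $(0,\mathcal T)$ with derivative $\partial_t\vartheta$; $\vartheta(\cdot,t)$ is continuous on $\overline\Omega$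 for $t\in(0,\mathcal T]$ (so $[\![\vartheta]\!]=0$) and takes the prescribed values on $\Gamma^\vartheta$ and at the inlet for these $t$; for $t\in(0,\mathcal T)$ it belongs to $H^1(\Omega)$ with $\int_\Omega\mathrm{grad}\,\vartheta\cdot\mathbf K\,\mathrm{grad}\,\vartheta<\infty$ and is absolutely continuous along $\Sigma$. The divergence is the weak divergence on $\Omega\setminus\Sigma$, and for $t\in(0,\mathcal T)$ the normal flux $\mathbf q\cdot\widehat{\mathbf n}$ on $\partial\Omega\setminus\Gamma^\vartheta$ and the jump $[\![\mathbf q]\!]$ across $\Sigma$ are the generalized normal traces given by $$\int_\Omega(\mathbf q\cdot\mathrm{grad}\,\xi+\xi\,\mathrm{div}\,\mathbf q)\,\mathrm d\Omega=\int_{\partial\Omega}\xi\,\mathbf q\cdot\widehat{\mathbf n}\,\mathrm d\Gamma+\int_{\Sigma}\xi\,[\![\mathbf q]\!]\,\mathrm ds$$ (all integrals being finite) for all $\xi\in H^1(\Omega)\cap C(\overline\Omega)$ with $\int_\Omega\mathrm{grad}\,\xi\cdot\mathbf K\,\mathrm{grad}\,\xi<\infty$ that vanish on $\Gamma^\vartheta$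 and at the inlet. If there is no radiation, $\varepsilon=0$, then the model has at most one solution: if $\vartheta_1$ and $\vartheta_2$ are solutions for the same data, then $\vartheta_1(\mathbf x,t)=\vartheta_2(\mathbf x,t)$ for all $\mathbf x\in\Omega$, $t\in[0,\mathcal T]$, and also for all $\mathbf x\in\overline\Omega$, $t\in(0,\mathcal T]$. -/

import Mathlib

open MeasureTheory Set Filter
open scoped Topology ContDiff RealInnerProductSpace

noncomputable section

namespace Geothermal

/-- Three-dimensional Euclidean space. -/
abbrev Space : Type := EuclideanSpace ℝ (Fin 3)

/-- The surface (area) measure: two-dimensional Hausdorff measure with the Euclidean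
normalization, so that it is the ordinary area on smooth surfaces. -/
def surfaceMeasure : Measure Space := μHE[2]

/-- `Ω` has a piecewise smooth boundary: the boundary has finite area and, off a closed subset
of area zero (edges and corners), it is locally the regular zero set of a `C¹` function with `Ω`
on one side of it. -/
def HasPiecewiseSmoothBoundary (Ω : Set Space) : Prop :=
  surfaceMeasure (frontier Ω) < ⊤ ∧
  ∃ S : Set Space, IsClosed S ∧ S ⊆ frontier Ω ∧ surfaceMeasure S = 0 ∧
    ∀ x ∈ frontier Ω \ S, ∃ (U : Set Space) (φ : Space → ℝ),
      IsOpen U ∧ x ∈ U ∧ ContDiffOn ℝ 1 φ U ∧ (∀ y ∈ U, gradient φ y ≠ 0) ∧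
      Ω ∩ U = {y ∈ U | φ y < 0}

/-- `γ` restricted to `[0, L]` is a simple piecewise `C¹` curve parametrized by arc-length:
it is continuous and injective, and `C¹` of unit speed off finitely many corners. -/
def IsArcLengthCurve (γ : ℝ → Space) (L : ℝ) : Prop :=
  ContinuousOn γ (Icc 0 L) ∧ InjOn γ (Icc 0 L) ∧
  ∃ P : Finset ℝ, ∀ s ∈ Ioo 0 L, s ∉ P → ContDiffAt ℝ 1 γ s ∧ ‖deriv γ s‖ = 1

/-- Smooth functions with compact support in `U`. -/
def IsTestFunction (U : Set Space) (φ : Space → ℝ) : Prop :=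
  ContDiff ℝ ∞ φ ∧ HasCompactSupport φ ∧ tsupport φ ⊆ U

/-- `G` is the weak gradient of `u` in `U`. -/
def IsWeakGradient (U : Set Space) (u : Space → ℝ) (G : Space → Space) : Prop :=
  LocallyIntegrableOn u U ∧ LocallyIntegrableOn G U ∧
  ∀ φ, IsTestFunction U φ → ∫ x in U, u x • gradient φ x = - ∫ x in U, φ x • G x

/-- `d` is the weak divergence of the vector field `q` in `U`. -/
def IsWeakDivergence (U : Set Space) (q : Space → Space) (d : Space → ℝ) : Prop :=
  LocallyIntegrableOn q U ∧ LocallyIntegrableOn d U ∧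
  ∀ φ, IsTestFunction U φ → ∫ x in U, ⟪q x, gradient φ x⟫ = - ∫ x in U, φ x * d x

/-- `v` is the time derivative at the time `t` of the time-dependent field `ϑ`, as a limit of
difference quotients in `L²(Ω)`. -/
def HasL2TimeDerivAt (Ω : Set Space) (ϑ : ℝ → Space → ℝ) (v : Space → ℝ) (t : ℝ) : Prop :=
  MemLp v 2 (volume.restrict Ω) ∧
  Tendsto (fun τ => eLpNorm (fun x => (ϑ τ x - ϑ t x) / (τ - t) - v x) 2 (volume.restrict Ω))
    (𝓝[≠] t) (𝓝 0)

/-- `ϑ` is continuous on `[0, T]` as an `L²(Ω)`-valued function of time. -/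
def IsL2Continuous (Ω : Set Space) (T : ℝ) (ϑ : ℝ → Space → ℝ) : Prop :=
  (∀ t ∈ Icc 0 T, MemLp (ϑ t) 2 (volume.restrict Ω)) ∧
  ∀ t ∈ Icc 0 T, Tendsto (fun τ => eLpNorm (fun x => ϑ τ x - ϑ t x) 2 (volume.restrict Ω))
    (𝓝[Icc 0 T] t) (𝓝 0)

/-- The geometry, the material parameters and the prescribed data of the model. -/
structure Model where
  /-- the domain -/
  Ω : Set Space
  isOpen_Ω : IsOpen Ω
  isBounded_Ω : Bornology.IsBounded Ω
  piecewiseSmooth : HasPiecewiseSmoothBoundary Ω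
  /-- the length of the time interval -/
  T : ℝ
  T_pos : 0 < T
  /-- the part of the boundary with prescribed temperature -/
  Γϑ : Set Space
  /-- the part of the boundary with prescribed normal heat flux -/
  Γq : Set Space
  /-- the part of the boundary that is free to convect and radiate -/
  ΓN : Set Space
  boundary_eq : Γϑ ∪ Γq ∪ ΓN = closure Ω \ Ω
  disjoint_ϑ_q : Disjoint Γϑ Γq
  disjoint_q_N : Disjoint Γq ΓN
  disjoint_N_ϑ : Disjoint ΓN Γϑ
  /-- the length of the vasculature -/
  L : ℝ
  L_pos : 0 < L
  /-- the vasculature, parametrized by arc-length from the inlet `γ 0` to the outlet `γ L` -/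
  γ : ℝ → Space
  isCurve : IsArcLengthCurve γ L
  curve_mem : ∀ s ∈ Ioo 0 L, γ s ∈ Ω
  inlet_mem : γ 0 ∈ closure Ω \ Ω
  outlet_mem : γ L ∈ closure Ω \ Ω
  /-- the density of the host solid -/
  ρs : Space → ℝ
  /-- the specific heat capacity of the host solid -/
  cs : Space → ℝ
  ρs_measurable : Measurable ρs
  cs_measurable : Measurable cs
  ρs_pos : ∀ x ∈ Ω, 0 < ρs x
  cs_pos : ∀ x ∈ Ω, 0 < cs x
  ρs_bounded : ∃ C, ∀ x ∈ Ω, ρs x ≤ C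
  cs_bounded : ∃ C, ∀ x ∈ Ω, cs x ≤ C
  /-- the conductivity tensor of the host solid -/
  K : Space → Space →L[ℝ] Space
  K_measurable : AEStronglyMeasurable K (volume.restrict Ω)
  K_posDef : ∀ x ∈ Ω, ∀ v : Space, v ≠ 0 → 0 < ⟪v, K x v⟫
  /-- the heat transfer coefficient -/
  hT : ℝ
  hT_nonneg : 0 ≤ hT
  /-- the emissivity -/
  ε : ℝ
  ε_nonneg : 0 ≤ ε
  /-- the Stefan-Boltzmann constant -/
  σ : ℝ
  σ_pos : 0 < σ
  /-- the density of the fluid -/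
  ρf : ℝ
  /-- the volumetric flow rate -/
  Q : ℝ
  mdot_nonneg : 0 ≤ ρf * Q
  /-- the specific heat capacity of the fluid -/
  cf : ℝ
  cf_nonneg : 0 ≤ cf
  /-- the ambient temperature -/
  ϑamb : ℝ
  /-- the inlet temperature -/
  ϑinlet : ℝ
  /-- the initial temperature -/
  ϑinitial : Space → ℝ
  /-- the prescribed boundary temperature, a function of time and position -/
  ϑp : ℝ → Space → ℝ
  /-- the prescribed normal heat flux, a function of time and position -/
  qp : ℝ → Space → ℝ

namespace Model

variable (M : Model)

/-- The vasculature as a set of points. -/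
def vasculature : Set Space := M.γ '' Icc 0 M.L

/-- The mass flow rate. -/
def mdot : ℝ := M.ρf * M.Q

/-- The heat capacity rate. -/
def χ : ℝ := M.mdot * M.cf

/-- `u` is a field of finite energy with gradient `G`: it is continuous on the closure of `Ω`
(so it has values on the boundary and no jump across the vasculature), it belongs to `H¹(Ω)`, and
`∫ grad u • K grad u` is finite (which is automatic if `K` is bounded). -/
structure IsEnergyField (u : Space → ℝ) (G : Space → Space) : Prop where
  continuousOn : ContinuousOn u (closure M.Ω)
  memLp : MemLp u 2 (volume.restrict M.Ω)
  memLp_grad : MemLp G 2 (volume.restrict M.Ω)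
  weakGradient : IsWeakGradient M.Ω u G
  energy : IntegrableOn (fun x => ⟪G x, M.K x (G x)⟫) M.Ω

/-- The weighting functions: fields of finite energy that vanish where the temperature is
prescribed, that is, on `Γϑ` and at the inlet. -/
structure IsWeighting (ξ : Space → ℝ) (G : Space → Space) : Prop where
  isEnergyField : M.IsEnergyField ξ G
  eq_zero : ∀ x ∈ M.Γϑ, ξ x = 0
  inlet : ξ (M.γ 0) = 0

/-- The heat flux `q`, with divergence `d` in `Ω` off the vasculature, has the normal component
`q • n = g` on the boundary (tested on the complement of `Γϑ`) and the jump `⟦q⟧ = j` across the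
vasculature, where `j` is a function of arc-length. As usual for fields that are merely integrable
with their divergence, both are defined by duality,
`∫_Ω (q • grad ξ + ξ div q) = ∫_∂Ω ξ (q • n) dΓ + ∫_Σ ξ ⟦q⟧ dΓ`.
The normals `n⁺` and `n⁻` in `⟦q⟧ = q⁺ • n⁺ + q⁻ • n⁻` point out of the solid, so `⟦q⟧` is the
heat that enters the vasculature per unit length. -/
def HasNormalTraces (q : Space → Space) (d g : Space → ℝ) (j : ℝ → ℝ) : Prop :=
  ∀ ξ G, M.IsWeighting ξ G →
    IntegrableOn (fun x => ⟪q x, G x⟫) M.Ω ∧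
    IntegrableOn (fun x => ξ x * d x) M.Ω ∧
    IntegrableOn (fun x => ξ x * g x) (closure M.Ω \ M.Ω) surfaceMeasure ∧
    IntervalIntegrable (fun s => ξ (M.γ s) * j s) volume 0 M.L ∧
    ∫ x in M.Ω, (⟪q x, G x⟫ + ξ x * d x) =
      (∫ x in closure M.Ω \ M.Ω, ξ x * g x ∂surfaceMeasure) + ∫ s in 0..M.L, ξ (M.γ s) * j s

/-- The governing equations at the time `t` with regard to the heat flux: there are a time
derivative `v`, a temperature gradient `G`, a heat flux `q` with divergence `d`, a normal heat
flux `g` on the boundary, and a jump `j` of the heat flux across the vasculature, such that the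
following hold. -/
def FluxEquationsAt (ϑ : ℝ → Space → ℝ) (t : ℝ) : Prop :=
  ∃ (v : Space → ℝ) (G q : Space → Space) (d g : Space → ℝ) (j : ℝ → ℝ),
    HasL2TimeDerivAt M.Ω ϑ v t ∧
    M.IsEnergyField (ϑ t) G ∧
    IsWeakDivergence (M.Ω \ M.vasculature) q d ∧
    M.HasNormalTraces q d g j ∧
    -- balance of energy in `Ω`
    (∀ᵐ x ∂(volume.restrict M.Ω), M.ρs x * M.cs x * v x + d x = 0) ∧
    -- Fourier's law in `Ω`
    (∀ᵐ x ∂(volume.restrict M.Ω), q x = - M.K x (G x)) ∧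
    -- prescribed heat flux
    (∀ x ∈ M.Γq, g x = M.qp t x) ∧
    -- convection and radiation
    (∀ x ∈ M.ΓN, g x = M.hT * (ϑ t x - M.ϑamb) + M.ε * M.σ * (ϑ t x ^ 4 - M.ϑamb ^ 4)) ∧
    -- jump of the heat flux: `⟦q⟧ = χ ∂ϑ/∂s`
    AbsolutelyContinuousOnInterval (fun s => ϑ t (M.γ s)) 0 M.L ∧
    (∀ᵐ s ∂(volume.restrict (Ioo 0 M.L)), j s = M.χ * deriv (fun s => ϑ t (M.γ s)) s)

/-- `ϑ` is a solution of the model: `ϑ t x` is the temperature at the time `t ∈ [0, T]` and the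
point `x` in the closure of `Ω`. -/
structure IsSolution (ϑ : ℝ → Space → ℝ) : Prop where
  continuous_in_time : IsL2Continuous M.Ω M.T ϑ
  continuous_in_space : ∀ t ∈ Ioc 0 M.T, ContinuousOn (ϑ t) (closure M.Ω)
  flux_equations : ∀ t ∈ Ioo 0 M.T, M.FluxEquationsAt ϑ t
  prescribed_temperature : ∀ t ∈ Ioc 0 M.T, ∀ x ∈ M.Γϑ, ϑ t x = M.ϑp t x
  initial : ∀ x ∈ M.Ω, ϑ 0 x = M.ϑinitial x
  inlet : ∀ t ∈ Ioc 0 M.T, ϑ t (M.γ 0) = M.ϑinlet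

end Model

end Geothermal

end

namespace Geothermal

/-! This is an energy argument. The difference `w = ϑ₁ - ϑ₂` vanishes on `Γϑ` and at the inlet, so
it is itself an admissible weighting function. Testing both flux identities with `w` and subtracting
gives `∫ ρs cs w ∂ₜw = -∫ grad w • K grad w - hT ∫_ΓN w² - χ ∫_Σ w ∂w/∂s`. The last integral is half
the square of `w` at the outlet, by `integral_mul_deriv_self`, so no term on the right is positive.
Here `ε = 0` matters: without a sign condition on the temperatures, `w (ϑ₁⁴ - ϑ₂⁴)` could be
negative.

By `ae_eq_zero_of_dissipative` the `L²` norm of `w` with weight `ρs cs` cannot grow from its initial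
value zero. Hence `w = 0` almost everywhere, and continuity in space gives equality on the closure
for positive times. -/

theorem IsTestFunction.continuous_gradient {U : Set Space} {φ : Space → ℝ}
    (hφ : IsTestFunction U φ) : Continuous (gradient φ) :=
  (InnerProductSpace.toDual ℝ Space).symm.continuous.comp (hφ.1.continuous_fderiv (by simp))

theorem gradient_eq_zero_of_notMem_tsupport {φ : Space → ℝ} {x : Space} (hx : x ∉ tsupport φ) :
    gradient φ x = 0 := by
  have : fderiv ℝ φ x = 0 := by
    by_contra h
    exact hx (support_fderiv_subset ℝ h)
  simp [gradient, this]

/-- The integrand lives on the compact support of `φ` inside `U`. Integrability is what allows weak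
gradient identities to be subtracted. -/
theorem IsTestFunction.integrableOn_smul_gradient {U : Set Space} {φ u : Space → ℝ}
    (hφ : IsTestFunction U φ) (hu : LocallyIntegrableOn u U) :
    IntegrableOn (fun x => u x • gradient φ x) U := by
  have hK : IntegrableOn (fun x => u x • gradient φ x) (tsupport φ) :=
    (hu.integrableOn_compact_subset hφ.2.2 hφ.2.1).smul_continuousOn
      hφ.continuous_gradient.continuousOn hφ.2.1
  refine (hK.integrable_of_forall_notMem_eq_zero fun x hx => ?_).integrableOn
  rw [gradient_eq_zero_of_notMem_tsupport hx, smul_zero]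

theorem IsTestFunction.integrableOn_smul {U : Set Space} {φ : Space → ℝ} {G : Space → Space}
    (hφ : IsTestFunction U φ) (hG : LocallyIntegrableOn G U) :
    IntegrableOn (fun x => φ x • G x) U := by
  have hK : IntegrableOn (fun x => φ x • G x) (tsupport φ) :=
    (hG.integrableOn_compact_subset hφ.2.2 hφ.2.1).continuousOn_smul
      hφ.1.continuous.continuousOn hφ.2.1
  refine (hK.integrable_of_forall_notMem_eq_zero fun x hx => ?_).integrableOn
  rw [image_eq_zero_of_notMem_tsupport hx, zero_smul]

theorem IsWeakGradient.sub {U : Set Space} {u₁ u₂ : Space → ℝ} {G₁ G₂ : Space → Space}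
    (h₁ : IsWeakGradient U u₁ G₁) (h₂ : IsWeakGradient U u₂ G₂) :
    IsWeakGradient U (fun x => u₁ x - u₂ x) (fun x => G₁ x - G₂ x) := by
  refine ⟨h₁.1.sub h₂.1, h₁.2.1.sub h₂.2.1, fun φ hφ => ?_⟩
  simp only [sub_smul, smul_sub]
  rw [integral_sub (hφ.integrableOn_smul_gradient h₁.1) (hφ.integrableOn_smul_gradient h₂.1),
    integral_sub (hφ.integrableOn_smul h₁.2.1) (hφ.integrableOn_smul h₂.2.1),
    h₁.2.2 φ hφ, h₂.2.2 φ hφ]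
  abel

/-- Parallelogram identity: the cross terms cancel even if `A` is not symmetric, and the term in `a
+ b` is nonnegative. It keeps the energy of a difference finite when `K` is unbounded. -/
theorem inner_map_sub_le {E : Type*} [NormedAddCommGroup E] [InnerProductSpace ℝ E]
    (A : E →L[ℝ] E) (hA : ∀ v, 0 ≤ ⟪v, A v⟫) (a b : E) :
    ⟪a - b, A (a - b)⟫ ≤ 2 * ⟪a, A a⟫ + 2 * ⟪b, A b⟫ := by
  have h := hA (a + b)
  simp only [map_add, map_sub, inner_add_left, inner_add_right, inner_sub_left,
    inner_sub_right] at h ⊢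
  linarith

theorem integral_mul_deriv_self {f : ℝ → ℝ} {a b : ℝ} (hf : AbsolutelyContinuousOnInterval f a b) :
    ∫ s in a..b, f s * deriv f s = (f b ^ 2 - f a ^ 2) / 2 := by
  have h := hf.integral_mul_deriv_eq_deriv_mul hf
  simp only [mul_comm (deriv f _)] at h
  linarith

/-! ### Time-dependent fields in `L²` and dissipation -/

theorem HasL2TimeDerivAt.sub {Ω : Set Space} {ϑ₁ ϑ₂ : ℝ → Space → ℝ} {v₁ v₂ : Space → ℝ} {t : ℝ}
    (h₁ : HasL2TimeDerivAt Ω ϑ₁ v₁ t) (h₂ : HasL2TimeDerivAt Ω ϑ₂ v₂ t)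
    (hm₁ : ∀ᶠ τ in 𝓝 t, MemLp (ϑ₁ τ) 2 (volume.restrict Ω))
    (hm₂ : ∀ᶠ τ in 𝓝 t, MemLp (ϑ₂ τ) 2 (volume.restrict Ω)) :
    HasL2TimeDerivAt Ω (fun τ x => ϑ₁ τ x - ϑ₂ τ x) (fun x => v₁ x - v₂ x) t := by
  refine ⟨h₁.1.sub h₂.1, ?_⟩
  have h0 := h₁.2.add h₂.2
  rw [add_zero] at h0
  refine tendsto_of_tendsto_of_tendsto_of_le_of_le' tendsto_const_nhds h0
    (Eventually.of_forall fun _ => zero_le) ?_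
  filter_upwards [hm₁.filter_mono nhdsWithin_le_nhds, hm₂.filter_mono nhdsWithin_le_nhds]
    with τ hτ₁ hτ₂
  have e : (fun x => (ϑ₁ τ x - ϑ₂ τ x - (ϑ₁ t x - ϑ₂ t x)) / (τ - t) - (v₁ x - v₂ x)) =
      (fun x => (ϑ₁ τ x - ϑ₁ t x) / (τ - t) - v₁ x) -
        (fun x => (ϑ₂ τ x - ϑ₂ t x) / (τ - t) - v₂ x) := by
    ext x; simp only [Pi.sub_apply]; ring
  have m₁ : AEStronglyMeasurable (fun x => (ϑ₁ τ x - ϑ₁ t x) / (τ - t) - v₁ x)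
      (volume.restrict Ω) := ((hτ₁.sub hm₁.self_of_nhds).1.div₀ aestronglyMeasurable_const).sub h₁.1.1
  have m₂ : AEStronglyMeasurable (fun x => (ϑ₂ τ x - ϑ₂ t x) / (τ - t) - v₂ x)
      (volume.restrict Ω) := ((hτ₂.sub hm₂.self_of_nhds).1.div₀ aestronglyMeasurable_const).sub h₂.1.1
  rw [e]
  exact eLpNorm_sub_le m₁ m₂ (by norm_num)

theorem IsL2Continuous.sub {Ω : Set Space} {T : ℝ} {ϑ₁ ϑ₂ : ℝ → Space → ℝ}
    (h₁ : IsL2Continuous Ω T ϑ₁) (h₂ : IsL2Continuous Ω T ϑ₂) :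
    IsL2Continuous Ω T (fun τ x => ϑ₁ τ x - ϑ₂ τ x) := by
  refine ⟨fun t ht => (h₁.1 t ht).sub (h₂.1 t ht), fun t ht => ?_⟩
  have h0 := (h₁.2 t ht).add (h₂.2 t ht)
  rw [add_zero] at h0
  refine tendsto_of_tendsto_of_tendsto_of_le_of_le' tendsto_const_nhds h0
    (Eventually.of_forall fun _ => zero_le) ?_
  filter_upwards [self_mem_nhdsWithin] with τ hτ
  have e : (fun x => ϑ₁ τ x - ϑ₂ τ x - (ϑ₁ t x - ϑ₂ t x)) =
      (fun x => ϑ₁ τ x - ϑ₁ t x) - (fun x => ϑ₂ τ x - ϑ₂ t x) := by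
    ext x; simp only [Pi.sub_apply]; ring
  rw [e]
  exact eLpNorm_sub_le ((h₁.1 τ hτ).sub (h₁.1 t ht)).1 ((h₂.1 τ hτ).sub (h₂.1 t ht)).1
    (by norm_num)

/-- A field that starts at zero and whose weighted square integral has nonpositive derivative
vanishes almost everywhere. -/
theorem ae_eq_zero_of_dissipative {Ω : Set Space} {T : ℝ} {w : ℝ → Space → ℝ} {ρ : Space → ℝ}
    (hΩ : MeasurableSet Ω) (hρ : Measurable ρ) (hpos : ∀ x ∈ Ω, 0 < ρ x)
    (hbdd : ∃ C, ∀ x ∈ Ω, ρ x ≤ C) (hw : IsL2Continuous Ω T w) (h0 : ∀ x ∈ Ω, w 0 x = 0)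
    (hd : ∀ t ∈ Ioo 0 T, ∃ v, HasL2TimeDerivAt Ω w v t ∧ ∫ x in Ω, ρ x * (w t x * v x) ≤ 0)
    {t : ℝ} (ht : t ∈ Icc 0 T) : ∀ᵐ x ∂(volume.restrict Ω), w t x = 0 := by
  classical
  set μ := volume.restrict Ω with hμ
  -- In `L²(ν)` the weighted square integral is a squared norm. The upper bound on `ρ` gives `ν ≤ C
  -- μ`, so `L²(μ)` limits are also `L²(ν)` limits.
  set ν := μ.withDensity (fun x => ENNReal.ofReal (ρ x)) with hν
  obtain ⟨C, hC⟩ := hbdd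
  have hνμ : ν ≤ ENNReal.ofReal C • μ := by
    rw [← withDensity_const]
    refine withDensity_mono ?_
    filter_upwards [ae_restrict_mem hΩ] with x hx
    exact ENNReal.ofReal_le_ofReal (hC x hx)
  have hle (f : Space → ℝ) :
      eLpNorm f 2 ν ≤ ENNReal.ofReal C ^ (1 / 2 : ℝ) * eLpNorm f 2 μ := by
    refine (eLpNorm_mono_measure f hνμ).trans ((eLpNorm_smul_measure_le _ _ _ _).trans_eq ?_)
    simp
  have hCtop : ENNReal.ofReal C ^ (1 / 2 : ℝ) ≠ ⊤ := by finiteness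
  have hmem {f : Space → ℝ} (hf : MemLp f 2 μ) : MemLp f 2 ν :=
    (hf.smul_measure (by finiteness)).mono_measure hνμ
  have hlim {l : Filter ℝ} {F : ℝ → Space → ℝ}
      (hF : Tendsto (fun τ => eLpNorm (F τ) 2 μ) l (𝓝 0)) :
      Tendsto (fun τ => eLpNorm (F τ) 2 ν) l (𝓝 0) := by
    have := ENNReal.Tendsto.const_mul hF (Or.inr hCtop)
    rw [mul_zero] at this
    exact tendsto_of_tendsto_of_tendsto_of_le_of_le tendsto_const_nhds this
      (fun _ => zero_le) (fun _ => hle _)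
  -- The default value 0 is never met on `[0, T]`.
  let W : ℝ → Lp ℝ 2 ν := fun τ => if h : MemLp (w τ) 2 ν then h.toLp else 0
  have hW {τ : ℝ} (hτ : τ ∈ Icc 0 T) : W τ = (hmem (hw.1 τ hτ)).toLp :=
    dif_pos (hmem (hw.1 τ hτ))
  have hcont : ContinuousOn W (Icc 0 T) := by
    intro s hs
    rw [ContinuousWithinAt, tendsto_iff_edist_tendsto_0]
    refine (hlim (hw.2 s hs)).congr' ?_
    filter_upwards [self_mem_nhdsWithin] with τ hτ
    rw [hW hτ, hW hs, Lp.edist_toLp_toLp]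
    rfl
  have hderiv : ∀ s ∈ Ioo 0 T, ∃ V, HasDerivAt W V s ∧ ⟪W s, V⟫ ≤ 0 := by
    intro s hs
    obtain ⟨v, hv, hneg⟩ := hd s hs
    have hs' := Ioo_subset_Icc_self hs
    refine ⟨(hmem hv.1).toLp, ?_, ?_⟩
    · rw [hasDerivAt_iff_tendsto_slope, tendsto_iff_edist_tendsto_0]
      refine (hlim hv.2).congr' ?_
      filter_upwards [(Icc_mem_nhds hs.1 hs.2 : _ ∈ 𝓝 s) |> mem_nhdsWithin_of_mem_nhds]
        with τ hτ
      have : slope W s τ =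
          (((hmem (hw.1 τ hτ)).sub (hmem (hw.1 s hs'))).const_smul (τ - s)⁻¹).toLp := by
        rw [slope, hW hτ, hW hs']
        rfl
      rw [this, Lp.edist_toLp_toLp]
      congr 1
      ext x
      simp [div_eq_inv_mul]
    · rw [L2.inner_def]
      have h1 : ∫ x, ⟪(W s : Space → ℝ) x, ((hmem hv.1).toLp : Space → ℝ) x⟫ ∂ν =
          ∫ x, w s x * v x ∂ν := by
        rw [hW hs']
        refine integral_congr_ae ?_
        filter_upwards [(hmem (hw.1 s hs')).coeFn_toLp, (hmem hv.1).coeFn_toLp] with x h1 h2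
        rw [h1, h2]
        simp [mul_comm]
      rw [h1, hν, integral_withDensity_eq_integral_toReal_smul hρ.ennreal_ofReal (by simp)]
      refine le_of_eq_of_le (integral_congr_ae ?_) hneg
      filter_upwards [ae_restrict_mem hΩ] with x hx
      simp [ENNReal.toReal_ofReal (hpos x hx).le]
  have hanti : AntitoneOn (fun s => ‖W s‖ ^ 2) (Icc 0 T) := by
    -- The derivative of `‖W‖²` is `2⟪W, V⟫`; at the endpoints continuity suffices.
    refine antitoneOn_of_deriv_nonpos (convex_Icc 0 T) (hcont.norm.pow 2) ?_ ?_
    · rw [interior_Icc]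
      intro s hs
      obtain ⟨V, hV, -⟩ := hderiv s hs
      exact hV.norm_sq.differentiableAt.differentiableWithinAt
    · rw [interior_Icc]
      intro s hs
      obtain ⟨V, hV, hn⟩ := hderiv s hs
      have := hV.norm_sq.deriv
      change deriv (fun s => ‖W s‖ ^ 2) s = _ at this
      rw [this]
      linarith
  have hT0 : (0 : ℝ) ∈ Icc 0 T := ⟨le_rfl, ht.1.trans ht.2⟩
  have hνae {p : Space → Prop} (hp : ∀ᵐ x ∂μ, p x) : ∀ᵐ x ∂ν, p x :=
    (withDensity_absolutelyContinuous μ _).ae_le hp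
  have hW0 : W 0 = 0 := by
    rw [hW hT0, Lp.eq_zero_iff_ae_eq_zero]
    refine (MemLp.coeFn_toLp _).trans (hνae ?_)
    filter_upwards [ae_restrict_mem hΩ] with x hx using h0 x hx
  have hWt : W t = 0 := by
    have h : ‖W t‖ ^ 2 ≤ ‖W 0‖ ^ 2 := hanti hT0 ht ht.1
    rw [hW0, norm_zero, zero_pow two_ne_zero] at h
    exact norm_eq_zero.1 (pow_eq_zero_iff two_ne_zero |>.1 (le_antisymm h (sq_nonneg _)))
  rw [hW ht, Lp.eq_zero_iff_ae_eq_zero] at hWt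
  -- Returning from `ν` to `μ` needs only `ρ > 0` pointwise, not a positive lower bound.
  have := (ae_withDensity_iff hρ.ennreal_ofReal).1 ((MemLp.coeFn_toLp _).symm.trans hWt)
  filter_upwards [this, ae_restrict_mem hΩ] with x hx hxΩ
  exact hx (by simpa using hpos x hxΩ)

/-! ### The energy inequality -/

namespace Model

variable {M : Model}

theorem inner_K_nonneg (M : Model) {x : Space} (hx : x ∈ M.Ω) (v : Space) :
    0 ≤ ⟪v, M.K x v⟫ := by
  rcases eq_or_ne v 0 with rfl | hv
  · simp
  · exact (M.K_posDef x hx v hv).le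

theorem IsEnergyField.sub {u₁ u₂ : Space → ℝ} {G₁ G₂ : Space → Space}
    (h₁ : M.IsEnergyField u₁ G₁) (h₂ : M.IsEnergyField u₂ G₂) :
    M.IsEnergyField (fun x => u₁ x - u₂ x) (fun x => G₁ x - G₂ x) where
  continuousOn := h₁.continuousOn.sub h₂.continuousOn
  memLp := h₁.memLp.sub h₂.memLp
  memLp_grad := h₁.memLp_grad.sub h₂.memLp_grad
  weakGradient := h₁.weakGradient.sub h₂.weakGradient
  energy := by
    have hm := (h₁.memLp_grad.sub h₂.memLp_grad).1
    refine Integrable.mono' ((h₁.energy.const_mul 2).add (h₂.energy.const_mul 2))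
      (hm.inner ((ContinuousLinearMap.id ℝ _).aestronglyMeasurable_comp₂ M.K_measurable hm)) ?_
    filter_upwards [ae_restrict_mem M.isOpen_Ω.measurableSet] with x hx
    rw [Real.norm_of_nonneg (M.inner_K_nonneg hx _)]
    exact inner_map_sub_le (M.K x) (M.inner_K_nonneg hx) (G₁ x) (G₂ x)

theorem χ_nonneg (M : Model) : 0 ≤ M.χ := mul_nonneg M.mdot_nonneg M.cf_nonneg

/-- The energy inequality for the difference of two solutions. -/
theorem exists_timeDeriv_dissipative (hε : M.ε = 0) {ϑ₁ ϑ₂ : ℝ → Space → ℝ}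
    (h₁ : M.IsSolution ϑ₁) (h₂ : M.IsSolution ϑ₂) {t : ℝ} (ht : t ∈ Ioo 0 M.T) :
    ∃ v, HasL2TimeDerivAt M.Ω (fun τ x => ϑ₁ τ x - ϑ₂ τ x) v t ∧
      ∫ x in M.Ω, M.ρs x * M.cs x * ((ϑ₁ t x - ϑ₂ t x) * v x) ≤ 0 := by
  obtain ⟨v₁, G₁, q₁, d₁, g₁, j₁, hv₁, hE₁, -, hN₁, hb₁, hF₁, hq₁, hc₁, ha₁, hj₁⟩ :=
    h₁.flux_equations t ht
  obtain ⟨v₂, G₂, q₂, d₂, g₂, j₂, hv₂, hE₂, -, hN₂, hb₂, hF₂, hq₂, hc₂, ha₂, hj₂⟩ :=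
    h₂.flux_equations t ht
  have hmem : ∀ᶠ τ in 𝓝 t, τ ∈ Icc 0 M.T := Icc_mem_nhds ht.1 ht.2
  refine ⟨fun x => v₁ x - v₂ x, hv₁.sub hv₂ (hmem.mono h₁.continuous_in_time.1)
    (hmem.mono h₂.continuous_in_time.1), ?_⟩
  have ht' : t ∈ Ioc 0 M.T := Ioo_subset_Ioc_self ht
  have hΩ := M.isOpen_Ω.measurableSet
  set w : Space → ℝ := fun x => ϑ₁ t x - ϑ₂ t x with hw
  set G : Space → Space := fun x => G₁ x - G₂ x with hG
  have hξ : M.IsWeighting w G :=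
    ⟨hE₁.sub hE₂, fun x hx => by
      simp [hw, h₁.prescribed_temperature t ht' x hx, h₂.prescribed_temperature t ht' x hx],
      by simp [hw, h₁.inlet t ht', h₂.inlet t ht']⟩
  obtain ⟨iq₁, id₁, ig₁, ij₁, e₁⟩ := hN₁ w G hξ
  obtain ⟨iq₂, id₂, ig₂, ij₂, e₂⟩ := hN₂ w G hξ
  have hbdry : 0 ≤ ∫ x in closure M.Ω \ M.Ω, (w x * g₁ x - w x * g₂ x) ∂surfaceMeasure := by
    refine setIntegral_nonneg (measurableSet_closure.diff hΩ) fun x hx => ?_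
    rw [← M.boundary_eq] at hx
    rcases hx with (hx | hx) | hx
    · simp [hξ.eq_zero x hx]
    · simp [hq₁ x hx, hq₂ x hx]
    -- Without radiation the ambient temperature cancels and `hT * w ^ 2` remains.
    · rw [hc₁ x hx, hc₂ x hx, hε]
      have : 0 ≤ M.hT * w x ^ 2 := mul_nonneg M.hT_nonneg (sq_nonneg _)
      refine this.trans_eq ?_
      simp only [hw]
      ring
  have hjump : 0 ≤ ∫ s in 0..M.L, (w (M.γ s) * j₁ s - w (M.γ s) * j₂ s) := by
    have hac : AbsolutelyContinuousOnInterval (fun s => w (M.γ s)) 0 M.L := ha₁.sub ha₂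
    have : ∫ s in 0..M.L, (w (M.γ s) * j₁ s - w (M.γ s) * j₂ s) =
        ∫ s in 0..M.L, M.χ * (w (M.γ s) * deriv (fun s => w (M.γ s)) s) := by
      -- The jump law is given on the open interval only; the endpoints are null.
      rw [intervalIntegral.integral_of_le M.L_pos.le, intervalIntegral.integral_of_le M.L_pos.le,
        integral_Ioc_eq_integral_Ioo, integral_Ioc_eq_integral_Ioo]
      refine integral_congr_ae ?_
      filter_upwards [hj₁, hj₂, ae_restrict_of_ae ha₁.ae_differentiableAt,
        ae_restrict_of_ae ha₂.ae_differentiableAt, ae_restrict_mem measurableSet_Ioo]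
        with s hs₁ hs₂ hd₁ hd₂ hs
      have hs' : s ∈ uIcc 0 M.L := by
        rw [uIcc_of_le M.L_pos.le]; exact Ioo_subset_Icc_self hs
      have hd : deriv (fun s => w (M.γ s)) s =
          deriv (fun s => ϑ₁ t (M.γ s)) s - deriv (fun s => ϑ₂ t (M.γ s)) s :=
        deriv_fun_sub (hd₁ hs') (hd₂ hs')
      rw [hs₁, hs₂, hd]
      ring
    rw [this, intervalIntegral.integral_const_mul, integral_mul_deriv_self hac]
    refine mul_nonneg M.χ_nonneg ?_
    rw [hξ.inlet]
    linarith [sq_nonneg (w (M.γ M.L))]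
  rw [integral_sub ig₁ ig₂] at hbdry
  rw [intervalIntegral.integral_sub ij₁ ij₂] at hjump
  have hi₁ : IntegrableOn (fun x => ⟪q₁ x, G x⟫ + w x * d₁ x) M.Ω := iq₁.add id₁
  have hi₂ : IntegrableOn (fun x => ⟪q₂ x, G x⟫ + w x * d₂ x) M.Ω := iq₂.add id₂
  have hi : IntegrableOn
      (fun x => ⟪q₁ x, G x⟫ + w x * d₁ x - (⟪q₂ x, G x⟫ + w x * d₂ x)) M.Ω := hi₁.sub hi₂
  have htot : 0 ≤ ∫ x in M.Ω, (⟪q₁ x, G x⟫ + w x * d₁ x - (⟪q₂ x, G x⟫ + w x * d₂ x)) := by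
    rw [integral_sub hi₁ hi₂, e₁, e₂]
    linarith
  -- The energy balance replaces `ρs cs v` by `-d`; adding and subtracting `⟪q, G⟫` exposes the
  -- tested flux, and Fourier's law turns the rest into the conduction energy.
  have hae : (fun x => M.ρs x * M.cs x * (w x * (v₁ x - v₂ x))) =ᵐ[volume.restrict M.Ω]
      fun x => -⟪G x, M.K x (G x)⟫ -
        (⟪q₁ x, G x⟫ + w x * d₁ x - (⟪q₂ x, G x⟫ + w x * d₂ x)) := by
    filter_upwards [hb₁, hb₂, hF₁, hF₂] with x hb₁ hb₂ hF₁ hF₂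
    have e : ⟪G x, M.K x (G x)⟫ = ⟪M.K x (G₁ x), G x⟫ - ⟪M.K x (G₂ x), G x⟫ := by
      rw [real_inner_comm, ← inner_sub_left, ← map_sub]
    rw [hF₁, hF₂, e, eq_neg_of_add_eq_zero_right hb₁, eq_neg_of_add_eq_zero_right hb₂,
      inner_neg_left, inner_neg_left]
    ring
  rw [integral_congr_ae hae, integral_sub hξ.isEnergyField.energy.fun_neg hi,
    integral_neg]
  have hK : 0 ≤ ∫ x in M.Ω, ⟪G x, M.K x (G x)⟫ :=
    setIntegral_nonneg hΩ fun x hx => M.inner_K_nonneg hx _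
  linarith

end Model

end Geothermal

theorem theorem1 (M : Geothermal.Model) (hε : M.ε = 0) (ϑ₁ ϑ₂ : ℝ → Geothermal.Space → ℝ)
    (h₁ : M.IsSolution ϑ₁) (h₂ : M.IsSolution ϑ₂) :
    (∀ t ∈ Icc 0 M.T, ∀ x ∈ M.Ω, ϑ₁ t x = ϑ₂ t x) ∧
      (∀ t ∈ Ioc 0 M.T, ∀ x ∈ closure M.Ω, ϑ₁ t x = ϑ₂ t x) := by
  have hclosure : ∀ t ∈ Ioc 0 M.T, EqOn (ϑ₁ t) (ϑ₂ t) (closure M.Ω) := by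
    intro t ht
    have hc₁ := h₁.continuous_in_space t ht
    have hc₂ := h₂.continuous_in_space t ht
    obtain ⟨C₁, hC₁⟩ := M.ρs_bounded
    obtain ⟨C₂, hC₂⟩ := M.cs_bounded
    have hae := Geothermal.ae_eq_zero_of_dissipative M.isOpen_Ω.measurableSet
      (M.ρs_measurable.mul M.cs_measurable)
      (fun x hx => mul_pos (M.ρs_pos x hx) (M.cs_pos x hx))
      ⟨C₁ * C₂, fun x hx => mul_le_mul (hC₁ x hx) (hC₂ x hx) (M.cs_pos x hx).le
        ((M.ρs_pos x hx).le.trans (hC₁ x hx))⟩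
      (h₁.continuous_in_time.sub h₂.continuous_in_time)
      (fun x hx => by simp [h₁.initial x hx, h₂.initial x hx])
      (fun s hs => Geothermal.Model.exists_timeDeriv_dissipative hε h₁ h₂ hs)
      (Ioc_subset_Icc_self ht)
    have hΩ : EqOn (ϑ₁ t) (ϑ₂ t) M.Ω :=
      Measure.eqOn_open_of_ae_eq (hae.mono fun x hx => sub_eq_zero.1 hx) M.isOpen_Ω
        (hc₁.mono subset_closure) (hc₂.mono subset_closure)
    exact hΩ.of_subset_closure hc₁ hc₂ subset_closure subset_rfl
  refine ⟨fun t ht x hx => ?_, fun t ht x hx => hclosure t ht hx⟩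
  -- Continuity in space is not assumed at time 0, where the initial condition gives equality
  -- directly.
  rcases eq_or_lt_of_le ht.1 with rfl | h
  · rw [h₁.initial x hx, h₂.initial x hx]
  · exact hclosure t ⟨h, ht.2⟩ (subset_closure hx)
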